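/- A hypergraph $G=(V,E)$ consists of a finite set $V$ of nodes and a set $E$ of subsets of $V$ of cardinality at least two, called edges; we assume that each node is contained in at least one edge. The multilinear polytope of $G$ is $$\mathrm{MP}(G)=\mathrm{conv}\Big\{z\in\{0,1\}^{V\cup E}: z_e=\prod_{v\in e}z_v\ \ \forall e\in E\Big\}.$$ Let $\mathrm{cl}(E)=\{f : |f|\ge 2,\ f\subseteq e \text{ for some } e\in E\}$, and let $E_{\max}$ be the set of edges of $G$ that are not contained in any other edge. With the convention that $z_\emptyset=1$ and $z_{\{v\}}=z_v$ for $v\in V$, let, for $U\subseteq e\in E_{\max}$, $$\psi(U,e)=\sum_{W\subseteq U,\ |W|\text{ even}}z_{(e\setminus U)\cup W}-\sum_{W\subseteq U,\ |W|\text{ odd}}z_{(e\setminus U)\cup W}.$$ The complete edge relaxation of $G$ is $$\mathrm{CER}(G)=\big\{z\in\mathbb{R}^{V\cup \mathrm{cl}(E)}:\psi(U,e)\ge 0\ \ \forall U\subseteq e,\ \forall e\in E_{\max}\big\}.$$ $\mathrm{CER}(G)$ is called an extension of $\mathrm{MP}(G)$ if it is a polyhedron whose projection onto the coordinates in $V\cup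 E$ is $\mathrm{MP}(G)$. The hypergraph $G$ is $\alpha$-acyclic if its edges can be ordered as $f_1,\dots,f_m$ so that for each $k=2,\dots,m$ there is $j<k$ with $f_k\cap\bigcup_{i<k}f_i\subseteq f_j$. Theorem. For every hypergraph $G$ in which each node is contained in at least one edge, $\mathrm{CER}(G)$ is an extension of $\mathrm{MP}(G)$ if and only if $G$ is $\alpha$-acyclic. -/

import Mathlib

/-- A polyhedron in `ℝ^ι`: the solution set of a finite system of linear inequalities. -/
def IsPolyhedron {ι : Type*} (P : Set (ι → ℝ)) : Prop :=
  ∃ s : Finset (Module.Dual ℝ (ι → ℝ) × ℝ), P = {x | ∀ c ∈ s, c.1 x ≤ c.2}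

/-- `Q ⊆ ℝ^κ` is an extension of the polyhedron `P ⊆ ℝ^ι`, where the coordinates `ι` of `P` are
regarded as some of the coordinates of `Q` through `f`: `Q` is a polyhedron, and `P` is the
projection of `Q` onto the coordinates in `ι`. (As a projection of a polyhedron, such a `P`
is itself a polyhedron, so this need not be demanded separately.) -/
def IsExtension {ι κ : Type*} (f : ι ↪ κ) (P : Set (ι → ℝ)) (Q : Set (κ → ℝ)) : Prop :=
  IsPolyhedron Q ∧ P = {x | ∃ z ∈ Q, ∀ i, z (f i) = x i}

/-- A collection `F` of sets has the running intersection property if its members can be listed,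
without repetition, as `f 0, …, f (m - 1)` such that for every `k` other than the first index there
is `j < k` with `f k ∩ (⋃ i < k, f i) ⊆ f j`. -/
def RunningIntersectionProperty {α : Type*} (F : Set (Set α)) : Prop :=
  ∃ (m : ℕ) (f : Fin m → Set α), Function.Injective f ∧ Set.range f = F ∧
    ∀ k : Fin m, 0 < (k : ℕ) → ∃ j : Fin m, j < k ∧ f k ∩ (⋃ i : Fin m, ⋃ _ : i < k, f i) ⊆ f j

namespace Hypergraph

variable {α : Type*}

/-- A hypergraph is α-acyclic if its edge set has the running intersection property. -/
def IsAlphaAcyclic (G : Hypergraph α) : Prop :=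
  RunningIntersectionProperty G.edgeSet

/-- The completion `cl(G)`: the edges are all subsets of cardinality at least two of edges
of `G`. -/
def completion (G : Hypergraph α) : Hypergraph α where
  vertexSet := G.vertexSet
  edgeSet := {f | 2 ≤ f.ncard ∧ ∃ e ∈ G.edgeSet, f ⊆ e}
  subset_vertexSet_of_mem_edgeSet' := by
    rintro f ⟨_, e, he, hfe⟩
    exact hfe.trans (G.subset_vertexSet_of_mem_edgeSet' he)

/-- The index set `V ∪ E` of the variables of a hypergraph, each node `v` being identified with
the singleton `{v}`, so that `z_v` and `z_{ {v} }` are the same variable. -/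
def coords (G : Hypergraph α) : Set (Finset α) :=
  {p | (∃ v ∈ G.vertexSet, p = {v}) ∨ (p : Set α) ∈ G.edgeSet}

/-- The coordinate `z_v` of a node `v`. -/
def node (G : Hypergraph α) {v : α} (hv : v ∈ G.vertexSet) : G.coords :=
  ⟨{v}, Or.inl ⟨v, hv, rfl⟩⟩

/-- The coordinate `z_e` of an edge `e`. -/
def edge (G : Hypergraph α) {e : Finset α} (he : (e : Set α) ∈ G.edgeSet) : G.coords :=
  ⟨e, Or.inr he⟩

theorem mem_vertexSet_of_mem (G : Hypergraph α) {e : Finset α} (he : (e : Set α) ∈ G.edgeSet)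
    (v : e) : (v : α) ∈ G.vertexSet :=
  G.subset_vertexSet_of_mem_edgeSet' he v.2

/-- The multilinear set: the binary points `z` of `ℝ^(V ∪ E)` with `z_e = ∏ v ∈ e, z_v` for every
edge `e`. -/
def multilinearSet (G : Hypergraph α) : Set (G.coords → ℝ) :=
  {z | (∀ p, z p = 0 ∨ z p = 1) ∧
    ∀ (e : Finset α) (he : (e : Set α) ∈ G.edgeSet),
      z (G.edge he) = ∏ v : e, z (G.node (G.mem_vertexSet_of_mem he v))}

/-- The multilinear polytope `MP(G)`. -/
def multilinearPolytope (G : Hypergraph α) : Set (G.coords → ℝ) :=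
  convexHull ℝ G.multilinearSet

open Classical in
/-- The value `z_p`, with the convention `z_∅ = 1`. For a nonempty `p` that is not a coordinate the
value is irrelevant; this never happens in the system that defines the complete edge
relaxation. -/
noncomputable def value (G : Hypergraph α) (z : G.coords → ℝ) (p : Finset α) : ℝ :=
  if p = ∅ then 1 else if h : p ∈ G.coords then z ⟨p, h⟩ else 0

/-- The expression `ψ(U, e)`: the sum of `z_((e \ U) ∪ W)` over the subsets `W` of `U` of even
cardinality, minus the same sum over those of odd cardinality. -/
noncomputable def rlt [DecidableEq α] (G : Hypergraph α) (z : G.coords → ℝ) (U e : Finset α) : ℝ :=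
  (∑ W ∈ U.powerset with Even W.card, G.value z ((e \ U) ∪ W)) -
    ∑ W ∈ U.powerset with Odd W.card, G.value z ((e \ U) ∪ W)

/-- The maximal edges of a hypergraph: those not contained in any other edge. -/
def IsMaximalEdge (G : Hypergraph α) (e : Finset α) : Prop :=
  Maximal (fun f : Finset α => (f : Set α) ∈ G.edgeSet) e

/-- The complete edge relaxation `CER(G)`, in the variables `V ∪ cl(E)`. -/
def completeEdgeRelaxation [DecidableEq α] (G : Hypergraph α) : Set (G.completion.coords → ℝ) :=
  {z | ∀ e : Finset α, G.IsMaximalEdge e → ∀ U ⊆ e, 0 ≤ G.completion.rlt z U e}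

/-- When all edges have at least two nodes, the variables `V ∪ E` are among the variables
`V ∪ cl(E)`. -/
theorem coords_subset_completion (G : Hypergraph α) (hE : ∀ e ∈ G.edgeSet, 2 ≤ e.ncard) :
    G.coords ⊆ G.completion.coords := by
  rintro p (hp | hp)
  · exact Or.inl hp
  · exact Or.inr ⟨hE _ hp, _, hp, subset_rfl⟩

end Hypergraph

/-!
Applied to moments `z_A = P(A ⊆ X)` of a random set `X`, the expression `ψ(U, e)` is the probability
that `X ∩ e = e \ U`. Hence a point of `CER(G)` is the same as a family of probability distributions
on the subsets of the edges that have common marginals on the intersections, while a point of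
`MP(G)` consists of the moments, at nodes and edges, of one distribution on the subsets of `V`. In
particular `CER(G)` always projects onto a superset of `MP(G)`, and the question is whether the
local distributions come from a global one.

If `G` is α-acyclic, they do: along a running intersection order, each edge meets the union of its
predecessors inside a single one of them, and distributions that agree on the intersection are glued
by making them conditionally independent (`exists_glued_moments`).

Conversely, let `CER(G)` project into `MP(G)`. Two families of locally consistent moments that no
global distribution can have at the nodes and edges, all nodes outside a small set being certainly
present, show that every clique of the 2-section of `G` lies in an edge
(`RelaxationProjectsInto.exists_edge_superset`) and that the 2-section is chordal in the sense of
`RelaxationProjectsInto.adj_of_common_component`. Chordality provides a simplicial vertex in each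
nonempty set of nodes (`exists_simplicial`); its neighbourhood there is a clique, hence covered by
an edge, and eliminating such nodes one after the other yields a running intersection order
(`exists_runsOn`).
-/

open Finset

/-! ### Moments of weighted families of finite sets -/

section Moments

variable {α : Type*} [DecidableEq α]

/-- The moment at `A` of the family of finite sets `T i` with weights `w i`: the total weight of the
members that contain `A`. Nonnegative weights with `moment w T ∅ = 1` amount to a finitely supported
probability distribution on finite sets, and `moment w T A` is then the probability that the random
set contains `A`. The index type is arbitrary, so that sets may be listed repeatedly. -/
def moment {ι : Type*} [Fintype ι] (w : ι → ℝ) (T : ι → Finset α) (A : Finset α) : ℝ :=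
  ∑ i, if A ⊆ T i then w i else 0

theorem sum_neg_one_pow_subset_eq_ite (T e U : Finset α) (hU : U ⊆ e) :
    ∑ W ∈ U.powerset, (-1 : ℝ) ^ W.card * (if (e \ U) ∪ W ⊆ T then 1 else 0) =
      if T ∩ e = e \ U then 1 else 0 := by
  by_cases hT : e \ U ⊆ T
  · have h1 : ∑ W ∈ U.powerset, (-1 : ℝ) ^ W.card * (if (e \ U) ∪ W ⊆ T then 1 else 0) =
        ∑ W ∈ (U ∩ T).powerset, (-1 : ℝ) ^ W.card := by
      simp only [mul_ite, mul_one, mul_zero]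
      rw [← sum_filter]
      refine sum_congr ?_ fun _ _ => rfl
      ext W
      simp only [mem_filter, mem_powerset, union_subset_iff, subset_inter_iff]
      tauto
    have h2 : (∑ W ∈ (U ∩ T).powerset, (-1 : ℝ) ^ W.card) = if U ∩ T = ∅ then 1 else 0 := by
      exact_mod_cast congrArg (Int.cast : ℤ → ℝ) (sum_powerset_neg_one_pow_card (x := U ∩ T))
    rw [h1, h2]
    refine if_congr ?_ rfl rfl
    constructor
    · intro h
      ext x
      have h3 := Finset.ext_iff.mp h x
      have h4 := @hT x
      simp only [mem_inter, mem_sdiff, notMem_empty] at *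
      tauto
    · intro h
      ext x
      have h3 := Finset.ext_iff.mp h x
      have h4 := @hU x
      simp only [mem_inter, mem_sdiff, notMem_empty] at *
      tauto
  · rw [if_neg, sum_eq_zero]
    · intro W _
      rw [if_neg, mul_zero]
      exact fun h => hT (subset_union_left.trans h)
    · intro h
      exact hT (h ▸ inter_subset_left)

/-- Möbius inversion of moments: the alternating sum that defines `ψ(U, e)` is the total weight of
the sets whose trace on `e` is exactly `e \ U`. -/
theorem sum_neg_one_pow_mul_moment {ι : Type*} [Fintype ι] (w : ι → ℝ) (T : ι → Finset α)
    {e U : Finset α} (hU : U ⊆ e) :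
    ∑ W ∈ U.powerset, (-1 : ℝ) ^ W.card * moment w T ((e \ U) ∪ W) =
      ∑ i, if T i ∩ e = e \ U then w i else 0 := by
  simp only [moment, mul_sum]
  rw [sum_comm]
  refine sum_congr rfl fun i _ => ?_
  have h := congrArg (w i * ·) (sum_neg_one_pow_subset_eq_ite (T i) e U hU)
  simp only [mul_sum, mul_ite, mul_one, mul_zero] at h
  rw [← h]
  refine sum_congr rfl fun W _ => ?_
  split_ifs <;> ring

theorem alternating_sum_nonneg {ι : Type*} [Fintype ι] {w : ι → ℝ} (hw : ∀ i, 0 ≤ w i)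
    (T : ι → Finset α) {z : Finset α → ℝ} {e U : Finset α} (hU : U ⊆ e)
    (h : ∀ A ⊆ e, moment w T A = z A) :
    0 ≤ ∑ W ∈ U.powerset, (-1 : ℝ) ^ W.card * z ((e \ U) ∪ W) := by
  have h1 : ∑ W ∈ U.powerset, (-1 : ℝ) ^ W.card * z ((e \ U) ∪ W) =
      ∑ W ∈ U.powerset, (-1 : ℝ) ^ W.card * moment w T ((e \ U) ∪ W) :=
    sum_congr rfl fun W hW => by
      rw [h _ (union_subset sdiff_subset ((mem_powerset.mp hW).trans hU))]
  rw [h1, sum_neg_one_pow_mul_moment w T hU]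
  exact sum_nonneg fun i _ => by split_ifs <;> simp [hw]

/-- The converse inversion: any set function `z` is recovered from its alternating sums, so these
serve as the weights of a family on the subsets of `e` with moments `z`. -/
theorem sum_superset_alternating (z : Finset α → ℝ) {A e : Finset α} (hA : A ⊆ e) :
    (∑ T ∈ e.powerset with A ⊆ T,
      ∑ W ∈ (e \ T).powerset, (-1 : ℝ) ^ W.card * z (T ∪ W)) = z A := by
  have h1 : ∀ T ∈ e.powerset.filter (A ⊆ ·),
      ∑ W ∈ (e \ T).powerset, (-1 : ℝ) ^ W.card * z (T ∪ W) =
        ∑ S ∈ e.powerset with T ⊆ S, (-1 : ℝ) ^ (S \ T).card * z S := by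
    intro T hT
    simp only [mem_filter, mem_powerset] at hT
    refine sum_bij' (fun W _ => T ∪ W) (fun S _ => S \ T) ?_ ?_ ?_ ?_ ?_
    · intro W hW
      simp only [mem_powerset, mem_filter] at *
      exact ⟨union_subset hT.1 (hW.trans sdiff_subset), subset_union_left⟩
    · intro S hS
      simp only [mem_powerset, mem_filter] at *
      exact sdiff_subset_sdiff hS.1 subset_rfl
    · intro W hW
      simp only [mem_powerset] at hW
      exact union_sdiff_cancel_left (disjoint_sdiff.mono_right hW)
    · intro S hS
      simp only [mem_filter] at hS
      exact union_sdiff_of_subset hS.2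
    · intro W hW
      simp only [mem_powerset] at hW
      simp only [union_sdiff_cancel_left (disjoint_sdiff.mono_right hW)]
  rw [sum_congr rfl h1]
  -- Exchanging the sums, the coefficient of `z S` is the alternating sum over the interval `[A, S]`,
  -- which vanishes unless `S = A`.
  have h2 : (∑ T ∈ e.powerset with A ⊆ T, ∑ S ∈ e.powerset with T ⊆ S,
        (-1 : ℝ) ^ (S \ T).card * z S) =
      ∑ S ∈ e.powerset with A ⊆ S, ∑ W ∈ (S \ A).powerset, (-1 : ℝ) ^ W.card * z S := by
    rw [sum_comm' (t' := e.powerset.filter (A ⊆ ·))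
      (s' := fun S => S.powerset.filter (A ⊆ ·))]
    · refine sum_congr rfl fun S hS => ?_
      simp only [mem_filter, mem_powerset] at hS
      refine sum_bij' (fun T _ => S \ T) (fun W _ => S \ W) ?_ ?_ ?_ ?_ ?_
      · intro T hT
        simp only [mem_powerset, mem_filter] at *
        exact sdiff_subset_sdiff subset_rfl hT.2
      · intro W hW
        simp only [mem_powerset, mem_filter] at *
        refine ⟨sdiff_subset, fun x hx => mem_sdiff.mpr ⟨hS.2 hx, fun h => ?_⟩⟩
        exact (mem_sdiff.mp (hW h)).2 hx
      · intro T hT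
        simp only [mem_filter, mem_powerset] at hT
        exact Finset.sdiff_sdiff_eq_self hT.1
      · intro W hW
        simp only [mem_powerset] at hW
        exact Finset.sdiff_sdiff_eq_self (hW.trans sdiff_subset)
      · intro T _
        rfl
    · intro T S
      simp only [mem_filter, mem_powerset]
      constructor
      · rintro ⟨⟨_, h1⟩, h2, h3⟩
        exact ⟨⟨h3, h1⟩, h2, h1.trans h3⟩
      · rintro ⟨⟨h3, h1⟩, h2, _⟩
        exact ⟨⟨h3.trans h2, h1⟩, h2, h3⟩
  rw [h2, sum_eq_single A]
  · simp
  · intro S hS hne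
    simp only [mem_filter, mem_powerset] at hS
    rw [← sum_mul]
    have h3 : (∑ W ∈ (S \ A).powerset, (-1 : ℝ) ^ W.card) = 0 := by
      have h4 := congrArg (Int.cast : ℤ → ℝ) (sum_powerset_neg_one_pow_card (x := S \ A))
      rw [if_neg] at h4
      · exact_mod_cast h4
      · rw [sdiff_eq_empty_iff_subset]
        exact fun h => hne (h.antisymm hS.2)
    rw [h3, zero_mul]
  · intro h
    simp [hA] at h

theorem subset_of_moment_eq {ι : Type*} [Fintype ι] {w : ι → ℝ} (hw : ∀ i, 0 ≤ w i)
    {T : ι → Finset α} {A B : Finset α} (hAB : A ⊆ B) (h : moment w T A = moment w T B)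
    {i : ι} (hi : w i ≠ 0) (hA : A ⊆ T i) : B ⊆ T i := by
  by_contra hB
  have := (sum_eq_sum_iff_of_le (s := univ) (f := fun i => if B ⊆ T i then w i else 0)
    (g := fun i => if A ⊆ T i then w i else 0) (fun i _ => by
      by_cases h1 : B ⊆ T i
      · simp [h1, hAB.trans h1]
      · simp only [h1, if_false]; split_ifs <;> simp [hw])).mp h.symm i (mem_univ i)
  simp only [hA, hB, if_true, if_false] at this
  exact hi this.symm

theorem not_subset_of_moment_eq_zero {ι : Type*} [Fintype ι] {w : ι → ℝ} (hw : ∀ i, 0 ≤ w i)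
    {T : ι → Finset α} {A : Finset α} (h : moment w T A = 0) {i : ι} (hi : w i ≠ 0) :
    ¬ A ⊆ T i := by
  intro hA
  have := (sum_eq_zero_iff_of_nonneg (s := univ) (f := fun i => if A ⊆ T i then w i else 0)
    (fun i _ => by split_ifs <;> simp [hw])).mp h i (mem_univ i)
  simp only [hA, if_true] at this
  exact hi this

theorem sum_ite_inter_eq_of_moment_eq {ι κ : Type*} [Fintype ι] [Fintype κ] {w : ι → ℝ}
    {u : κ → ℝ} {T : ι → Finset α} {R : κ → Finset α} {I : Finset α}
    (h : ∀ A ⊆ I, moment w T A = moment u R A) {B : Finset α} (hB : B ⊆ I) :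
    (∑ i, if T i ∩ I = B then w i else 0) = ∑ j, if R j ∩ I = B then u j else 0 := by
  have h1 := sum_neg_one_pow_mul_moment w T (e := I) (U := I \ B) sdiff_subset
  have h2 := sum_neg_one_pow_mul_moment u R (e := I) (U := I \ B) sdiff_subset
  rw [Finset.sdiff_sdiff_eq_self hB] at h1 h2
  rw [← h1, ← h2]
  refine sum_congr rfl fun W hW => ?_
  rw [h _ (union_subset hB ((mem_powerset.mp hW).trans sdiff_subset))]

/-- Summing out the second component of the conditionally independent coupling of two families with
the same trace distribution on `I` returns the first weight. A vanishing denominator forces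
`w i = 0`, so the convention `x / 0 = 0` gives the right value. -/
theorem sum_mul_ite_div_cancel {ι κ : Type*} [Fintype ι] [Fintype κ] {w : ι → ℝ} {u : κ → ℝ}
    {T : ι → Finset α} {R : κ → Finset α} {I : Finset α} (hw : ∀ i, 0 ≤ w i)
    (h : ∀ A ⊆ I, moment w T A = moment u R A) (i : ι) :
    (∑ j, if T i ∩ I = R j ∩ I then
      w i * u j / (∑ k, if T k ∩ I = T i ∩ I then w k else 0) else 0) = w i := by
  have h1 := sum_ite_inter_eq_of_moment_eq h (B := T i ∩ I) inter_subset_right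
  have h2 : (∑ j, if T i ∩ I = R j ∩ I then
      w i * u j / (∑ k, if T k ∩ I = T i ∩ I then w k else 0) else 0) =
      w i * (∑ j, if R j ∩ I = T i ∩ I then u j else 0) /
        (∑ k, if T k ∩ I = T i ∩ I then w k else 0) := by
    rw [mul_sum, sum_div]
    refine sum_congr rfl fun j _ => ?_
    by_cases hj : R j ∩ I = T i ∩ I
    · rw [if_pos hj.symm, if_pos hj]
    · rw [if_neg (Ne.symm hj), if_neg hj]; simp
  rw [h2, ← h1]
  by_cases h0 : (∑ k, if T k ∩ I = T i ∩ I then w k else 0) = 0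
  · have h3 := (sum_eq_zero_iff_of_nonneg (fun k _ => by split_ifs <;> simp [hw])).mp h0
      i (mem_univ i)
    simp only [if_true] at h3
    simp [h3]
  · field_simp

/-- Two distributions on the subsets of `X` and of `Y` that agree on `X ∩ Y` have a common extension
to the subsets of `X ∪ Y`: draw both sets independently conditionally on their common trace on
`X ∩ Y`, and take the union. -/
theorem exists_glued_moments {ι κ : Type*} [Fintype ι] [Fintype κ] {w : ι → ℝ} {u : κ → ℝ}
    {T : ι → Finset α} {R : κ → Finset α} {X Y : Finset α} (hw : ∀ i, 0 ≤ w i)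
    (hu : ∀ j, 0 ≤ u j) (hT : ∀ i, T i ⊆ X) (hR : ∀ j, R j ⊆ Y)
    (h : ∀ A ⊆ X ∩ Y, moment w T A = moment u R A) :
    ∃ p : ι × κ → ℝ, (∀ q, 0 ≤ p q) ∧
      (∀ A ⊆ X, moment p (fun q => T q.1 ∪ R q.2) A = moment w T A) ∧
      ∀ A ⊆ Y, moment p (fun q => T q.1 ∪ R q.2) A = moment u R A := by
  set I := X ∩ Y with hI
  -- When the traces on `I` agree, the union restricts to `T i` on `X` and to `R j` on `Y`.
  have agree : ∀ i j, T i ∩ I = R j ∩ I →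
      (∀ A ⊆ X, A ⊆ T i ∪ R j ↔ A ⊆ T i) ∧ ∀ A ⊆ Y, A ⊆ T i ∪ R j ↔ A ⊆ R j := by
    intro i j hij
    refine ⟨fun A hA => ⟨fun hs x hx => ?_, fun hs => hs.trans subset_union_left⟩,
      fun A hA => ⟨fun hs x hx => ?_, fun hs => hs.trans subset_union_right⟩⟩
    · rcases mem_union.mp (hs hx) with h1 | h1
      · exact h1
      · have : x ∈ T i ∩ I := hij ▸ mem_inter.mpr ⟨h1, mem_inter.mpr ⟨hA hx, hR j h1⟩⟩
        exact (mem_inter.mp this).1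
    · rcases mem_union.mp (hs hx) with h1 | h1
      · have : x ∈ R j ∩ I := hij ▸ mem_inter.mpr ⟨h1, mem_inter.mpr ⟨hT i h1, hA hx⟩⟩
        exact (mem_inter.mp this).1
      · exact h1
  refine ⟨fun q => if T q.1 ∩ I = R q.2 ∩ I then
    w q.1 * u q.2 / (∑ k, if T k ∩ I = T q.1 ∩ I then w k else 0) else 0, ?_, ?_, ?_⟩
  · rintro ⟨i, j⟩
    dsimp only
    split_ifs
    · exact div_nonneg (mul_nonneg (hw i) (hu j))
        (sum_nonneg fun k _ => by split_ifs <;> simp [hw])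
    · exact le_rfl
  · intro A hA
    rw [moment, Fintype.sum_prod_type]
    refine sum_congr rfl fun i _ => ?_
    dsimp only
    by_cases hi : A ⊆ T i
    · rw [if_pos hi]
      conv_rhs => rw [← sum_mul_ite_div_cancel hw h i]
      exact sum_congr rfl fun j _ => if_pos (hi.trans subset_union_left)
    · rw [if_neg hi]
      refine sum_eq_zero fun j _ => ?_
      by_cases hij : T i ∩ I = R j ∩ I
      · rw [if_neg]
        rwa [(agree i j hij).1 A hA]
      · simp [hij]
  · intro A hA
    rw [moment, Fintype.sum_prod_type_right]
    refine sum_congr rfl fun j _ => ?_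
    dsimp only
    by_cases hj : A ⊆ R j
    · rw [if_pos hj]
      conv_rhs => rw [← sum_mul_ite_div_cancel hu (fun A hA => (h A hA).symm) j]
      refine sum_congr rfl fun i _ => ?_
      rw [if_pos (hj.trans subset_union_right)]
      by_cases hij : T i ∩ I = R j ∩ I
      · rw [if_pos hij, if_pos hij.symm, mul_comm (w i), hij,
          sum_ite_inter_eq_of_moment_eq h inter_subset_right]
      · rw [if_neg hij, if_neg (Ne.symm hij)]
    · rw [if_neg hj]
      refine sum_eq_zero fun i _ => ?_
      by_cases hij : T i ∩ I = R j ∩ I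
      · rw [if_neg]
        rwa [(agree i j hij).2 A hA]
      · simp [hij]

end Moments

/-! ### Simplicial vertices -/

section Simplicial

variable {α : Type*} [DecidableEq α]

/-- The vertex set `C` is connected for `adj`, in the form in which this is used: every predicate
that is invariant under adjacency inside `C` is constant on `C`. The empty set qualifies. -/
def IsConnectedIn (adj : α → α → Prop) (C : Finset α) : Prop :=
  ∀ P : α → Prop, (∀ u ∈ C, ∀ v ∈ C, adj u v → (P u ↔ P v)) → ∀ u ∈ C, ∀ v ∈ C, (P u ↔ P v)

theorem IsConnectedIn.insert {adj : α → α → Prop} {C : Finset α} (hC : IsConnectedIn adj C)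
    {b c : α} (hc : c ∈ C) (hbc : adj b c) : IsConnectedIn adj (insert b C) := by
  intro P hP
  have h1 := hC P fun u hu v hv => hP u (mem_insert_of_mem hu) v (mem_insert_of_mem hv)
  have h2 : ∀ u ∈ Insert.insert b C, (P u ↔ P c) := by
    intro u hu
    rcases mem_insert.mp hu with rfl | hu
    · exact hP u (mem_insert_self _ _) c (mem_insert_of_mem hc) hbc
    · exact h1 u hu c hc
  exact fun u hu v hv => (h2 u hu).trans (h2 v hv).symm

/-- Existence of a simplicial vertex, as for chordal graphs. Chordality enters through `hch`: two
common neighbours `b`, `b'` of a vertex `a` and a connected set `C` not adjacent to `a` are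
adjacent. (Otherwise a shortest path from `b` to `b'` through `C`, closed up by `a`, would be a
chordless cycle.) -/
theorem exists_simplicial {adj : α → α → Prop} (hsymm : ∀ u v, adj u v → adj v u)
    (X : Finset α) (hX : X.Nonempty)
    (hch : ∀ C ⊆ X, IsConnectedIn adj C → ∀ a ∈ X, ∀ b ∈ X, ∀ b' ∈ X, a ∉ C →
      (∀ c ∈ C, ¬ adj a c) → (∃ c ∈ C, adj b c) → (∃ c ∈ C, adj b' c) → adj a b → adj a b' →
      b ≠ b' → adj b b') :
    ∃ v ∈ X, ∀ x ∈ X, ∀ y ∈ X, adj v x → adj v y → x ≠ y → adj x y := by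
  induction X using Finset.strongInduction with
  | H X ih =>
    classical
    by_cases hcomplete : ∀ x ∈ X, ∀ y ∈ X, x ≠ y → adj x y
    · obtain ⟨v, hv⟩ := hX
      exact ⟨v, hv, fun x hx y hy _ _ hxy => hcomplete x hx y hy hxy⟩
    push Not at hcomplete
    obtain ⟨s, hs, t, ht, hst, hnst⟩ := hcomplete
    -- Choose a largest connected `C` that leaves a vertex outside its closed neighbourhood. By
    -- maximality, a neighbour of `C` is adjacent to every vertex outside that neighbourhood.
    let 𝒞 := X.powerset.filter fun C => C.Nonempty ∧ IsConnectedIn adj C ∧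
      ∃ a ∈ X, a ∉ C ∧ ∀ c ∈ C, ¬ adj a c
    have hne : 𝒞.Nonempty := by
      refine ⟨{s}, mem_filter.mpr ⟨by simpa using hs, by simp, ?_, t, ht, by simpa using hst.symm,
        ?_⟩⟩
      · intro P _ u hu v hv
        rw [mem_singleton.mp hu, mem_singleton.mp hv]
      · intro c hc hadj
        rw [mem_singleton.mp hc] at hadj
        exact hnst (hsymm _ _ hadj)
    obtain ⟨C, hC, hmax⟩ := 𝒞.exists_max_image Finset.card hne
    obtain ⟨hCX, ⟨c₀, hc₀⟩, hconn, a₀, ha₀, ha₀C, ha₀adj⟩ := mem_filter.mp hC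
    rw [mem_powerset] at hCX
    let A := X.filter fun x => x ∉ C ∧ ∀ c ∈ C, ¬ adj x c
    have hAX : A ⊆ X := filter_subset _ _
    have hAssub : A ⊂ X :=
      ⟨hAX, fun h => (mem_filter.mp (h (hCX hc₀))).2.1 hc₀⟩
    obtain ⟨v, hvA, hv⟩ := ih A hAssub ⟨a₀, mem_filter.mpr ⟨ha₀, ha₀C, ha₀adj⟩⟩
      (fun D hD hDc a ha b hb b' hb' => hch D (hD.trans hAX) hDc a (hAX ha) b (hAX hb) b' (hAX hb'))
    obtain ⟨hvX, hvC, hvadj⟩ := mem_filter.mp hvA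
    have hcases : ∀ x ∈ X, adj v x → x ∈ A ∨ ∃ c ∈ C, adj x c := by
      intro x hx hvx
      by_contra! hcon
      exact hcon.1 (mem_filter.mpr ⟨hx, fun hxC => hvadj x hxC hvx, hcon.2⟩)
    have hjoin : ∀ x ∈ X, ∀ y ∈ A, (∃ c ∈ C, adj x c) → adj v x → x ≠ y → adj x y := by
      rintro x hx y hy ⟨c, hc, hxc⟩ hvx hxy
      by_contra hnxy
      obtain ⟨hyX, hyC, hyadj⟩ := mem_filter.mp hy
      have hmem : insert x C ∈ 𝒞 := by
        refine mem_filter.mpr ⟨mem_powerset.mpr (insert_subset hx hCX), by simp,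
          hconn.insert hc hxc, y, hyX, ?_, ?_⟩
        · rw [mem_insert, not_or]
          exact ⟨hxy.symm, hyC⟩
        · intro d hd hyd
          rcases mem_insert.mp hd with rfl | hd
          · exact hnxy (hsymm _ _ hyd)
          · exact hyadj d hd hyd
      have hle := hmax _ hmem
      rw [card_insert_of_notMem fun hxC => hvadj x hxC hvx] at hle
      omega
    refine ⟨v, hvX, fun x hx y hy hvx hvy hxy => ?_⟩
    rcases hcases x hx hvx with hxA | hxB <;> rcases hcases y hy hvy with hyA | hyB
    · exact hv x hxA y hyA hvx hvy hxy
    · exact hsymm _ _ (hjoin y hy x hxA hyB hvy hxy.symm)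
    · exact hjoin x hx y hyA hxB hvx hxy
    · exact hch C hCX hconn v hvX x hx y hy hvC hvadj hxB hyB hvx hvy hxy

end Simplicial

/-! ### Running intersection orders by elimination of nodes -/

section RunningIntersection

variable {α : Type*}

/-- The list of sets has the running intersection property with all sets replaced by their traces
on `X`. The list is read backwards: the head is the last set of the order, and its intersection
with the sets in the tail lies in one of them. Distinct members may have equal traces. -/
def RunsOn (X : Finset α) : List (Finset α) → Prop
  | [] => True
  | e :: L => RunsOn X L ∧
      (L ≠ [] → ∃ f ∈ L, ∀ x ∈ X, x ∈ e → (∃ g ∈ L, x ∈ g) → x ∈ f)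

theorem runsOn_empty : ∀ L : List (Finset α), RunsOn ∅ L
  | [] => trivial
  | e :: L => by
    refine ⟨runsOn_empty L, fun hL => ?_⟩
    obtain ⟨f, hf⟩ := List.exists_mem_of_ne_nil L hL
    exact ⟨f, hf, by simp⟩

/-- Sets whose trace on `X` is covered by a member of the list may be placed after it. -/
theorem RunsOn.append {X : Finset α} {L : List (Finset α)} (hL : RunsOn X L) {f : Finset α}
    (hf : f ∈ L) : ∀ M : List (Finset α), (∀ e ∈ M, ∀ x ∈ X, x ∈ e → x ∈ f) → RunsOn X (M ++ L)
  | [], _ => hL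
  | e :: M, hM => by
    refine ⟨hL.append hf M fun e he => hM e (List.mem_cons_of_mem _ he), fun _ => ?_⟩
    exact ⟨f, List.mem_append_right _ hf, fun x hx hxe _ => hM e List.mem_cons_self x hx hxe⟩

theorem RunsOn.exists_index {X : Finset α} : ∀ {L : List (Finset α)}, RunsOn X L →
    ∀ p : ℕ, p + 1 < L.length → ∃ q : ℕ, ∃ hq : q < L.length, p < q ∧
      ∀ x ∈ X, ∀ hp : p < L.length, x ∈ L[p] →
        (∃ r, ∃ hr : r < L.length, p < r ∧ x ∈ L[r]) → x ∈ L[q]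
  | [], _, p, hp => by simp at hp
  | e :: L, ⟨h1, h2⟩, 0, hp => by
    obtain ⟨f, hf, hfx⟩ := h2 (by rintro rfl; simp at hp)
    obtain ⟨q, hq, rfl⟩ := List.mem_iff_getElem.mp hf
    refine ⟨q + 1, by simpa using hq, by omega, ?_⟩
    rintro x hx _ hxe ⟨r, hr, hr0, hxr⟩
    obtain ⟨r, rfl⟩ := Nat.exists_eq_succ_of_ne_zero hr0.ne'
    exact hfx x hx hxe ⟨L[r]'(by simpa using hr), List.getElem_mem _, hxr⟩
  | e :: L, ⟨h1, h2⟩, p + 1, hp => by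
    obtain ⟨q, hq, hpq, h⟩ := h1.exists_index p (by simpa using hp)
    refine ⟨q + 1, by simpa using hq, by omega, ?_⟩
    rintro x hx hp' hxe ⟨r, hr, hr0, hxr⟩
    obtain ⟨r, rfl⟩ := Nat.exists_eq_succ_of_ne_zero (show r ≠ 0 by omega)
    exact h x hx (by simpa using hp') hxe ⟨r, by simpa using hr, by omega, hxr⟩

variable [DecidableEq α]

/-- A node that lies in only one set of the list occurs in no intersection with earlier sets. -/
theorem RunsOn.of_erase {X : Finset α} {v : α} : ∀ {L : List (Finset α)},
    RunsOn (X.erase v) L → L.Nodup → (∀ e ∈ L, ∀ g ∈ L, v ∈ e → v ∈ g → e = g) → RunsOn X L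
  | [], _, _, _ => trivial
  | e :: L, ⟨h1, h2⟩, hnd, hv => by
    rw [List.nodup_cons] at hnd
    refine ⟨h1.of_erase hnd.2 fun e he g hg =>
      hv e (List.mem_cons_of_mem _ he) g (List.mem_cons_of_mem _ hg), fun hL => ?_⟩
    obtain ⟨f, hf, hfx⟩ := h2 hL
    refine ⟨f, hf, fun x hx hxe hxg => ?_⟩
    by_cases hxv : x = v
    · subst hxv
      obtain ⟨g, hg, hxg⟩ := hxg
      have := hv e List.mem_cons_self g (List.mem_cons_of_mem _ hg) hxe hxg
      exact absurd (this ▸ hg) hnd.1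
    · exact hfx x (mem_erase.mpr ⟨hxv, hx⟩) hxe hxg

/-- If every nonempty `X ⊆ V` has a node whose edges jointly have their trace on `X` inside a single
edge, then the edges have a running intersection order. The induction removes such a node `v` from
`X`; it runs over all subfamilies `F` that cover the traces of the edges, because all sets of `F`
through `v` but one are set aside and placed at the end of the order. -/
theorem exists_runsOn {E : Finset (Finset α)} (V : Finset α)
    (hsimp : ∀ X ⊆ V, X.Nonempty → ∃ v ∈ X, ∃ e ∈ E, v ∈ e ∧
      ∀ x ∈ X, (∃ g ∈ E, v ∈ g ∧ x ∈ g) → x ∈ e)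
    (X : Finset α) : X ⊆ V → ∀ F ⊆ E, (∀ e ∈ E, ∃ f ∈ F, ∀ x ∈ X, x ∈ e → x ∈ f) →
      ∃ L : List (Finset α), L.Nodup ∧ (∀ e, e ∈ L ↔ e ∈ F) ∧ RunsOn X L := by
  induction X using Finset.strongInduction with
  | H X ih =>
    intro hXV F hFE hcov
    rcases X.eq_empty_or_nonempty with rfl | hX
    · exact ⟨F.toList, F.nodup_toList, fun e => mem_toList, runsOn_empty _⟩
    obtain ⟨v, hvX, e, he, hve, hcl⟩ := hsimp X hXV hX
    obtain ⟨f₀, hf₀, hef₀⟩ := hcov e he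
    have hvf₀ : v ∈ f₀ := hef₀ v hvX hve
    have hleaf : ∀ g ∈ E, v ∈ g → ∀ x ∈ X, x ∈ g → x ∈ f₀ := fun g hg hvg x hx hxg =>
      hef₀ x hx (hcl x hx ⟨g, hg, hvg, hxg⟩)
    obtain ⟨L, hnd, hmem, hL⟩ := ih (X.erase v) (erase_ssubset hvX) ((erase_subset _ _).trans hXV)
      (F.filter fun g => v ∈ g → g = f₀) ((filter_subset _ _).trans hFE) (by
        intro g hg
        by_cases hvg : v ∈ g
        · exact ⟨f₀, mem_filter.mpr ⟨hf₀, fun _ => rfl⟩,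
            fun x hx => hleaf g hg hvg x (mem_of_mem_erase hx)⟩
        · obtain ⟨f, hf, hgf⟩ := hcov g hg
          by_cases hvf : v ∈ f
          · exact ⟨f₀, mem_filter.mpr ⟨hf₀, fun _ => rfl⟩, fun x hx hxg =>
              hleaf f (hFE hf) hvf x (mem_of_mem_erase hx) (hgf x (mem_of_mem_erase hx) hxg)⟩
          · exact ⟨f, mem_filter.mpr ⟨hf, fun h => absurd h hvf⟩,
              fun x hx => hgf x (mem_of_mem_erase hx)⟩)
    have hf₀L : f₀ ∈ L := (hmem f₀).mpr (mem_filter.mpr ⟨hf₀, fun _ => rfl⟩)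
    refine ⟨(F.filter fun g => ¬ (v ∈ g → g = f₀)).toList ++ L, ?_, ?_, ?_⟩
    · refine List.nodup_append'.mpr ⟨nodup_toList _, hnd, ?_⟩
      intro g hg hgL
      exact (mem_filter.mp (mem_toList.mp hg)).2 (mem_filter.mp ((hmem g).mp hgL)).2
    · intro g
      rw [List.mem_append, mem_toList, hmem, mem_filter, mem_filter]
      tauto
    · refine (hL.of_erase hnd ?_).append hf₀L _ ?_
      · intro g hg g' hg' hvg hvg'
        rw [(mem_filter.mp ((hmem g).mp hg)).2 hvg, (mem_filter.mp ((hmem g').mp hg')).2 hvg']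
      · intro g hg
        obtain ⟨hgF, hg⟩ := mem_filter.mp (mem_toList.mp hg)
        push Not at hg
        exact hleaf g (hFE hgF) hg.1

end RunningIntersection

namespace Hypergraph

/-! ### The relaxation and the polytope in terms of moments -/

section Relaxation

variable {α : Type*} (G : Hypergraph α)

theorem value_of_mem {z : G.coords → ℝ} {p : Finset α} (hp : p ∈ G.coords) (hne : p ≠ ∅) :
    G.value z p = z ⟨p, hp⟩ := by
  rw [value, if_neg hne, dif_pos hp]

theorem value_empty (z : G.coords → ℝ) : G.value z ∅ = 1 := by
  rw [value, if_pos rfl]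

theorem ne_empty_of_mem_coords (hE : ∀ e ∈ G.edgeSet, 2 ≤ e.ncard) {p : Finset α}
    (hp : p ∈ G.coords) : p ≠ ∅ := by
  rintro rfl
  rcases hp with ⟨v, _, h⟩ | h
  · exact (singleton_ne_empty v) h.symm
  · have := hE _ h
    simp at this

theorem coords_completion_of_subset {e A : Finset α} (he : (e : Set α) ∈ G.edgeSet) (hA : A ⊆ e)
    (hne : A ≠ ∅) : A ∈ G.completion.coords := by
  rcases Nat.lt_or_ge A.card 2 with h | h
  · have h1 : A.card = 1 := by
      have := (nonempty_iff_ne_empty.mpr hne).card_pos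
      omega
    obtain ⟨v, rfl⟩ := card_eq_one.mp h1
    exact Or.inl ⟨v, G.subset_vertexSet_of_mem_edgeSet' he (hA (mem_singleton_self v)), rfl⟩
  · exact Or.inr ⟨by rwa [Set.ncard_coe_finset], e, he, by exact_mod_cast hA⟩

theorem exists_subset_of_mem_coords_completion (hcov : ∀ v ∈ G.vertexSet, ∃ e ∈ G.edgeSet, v ∈ e)
    {A : Finset α} (hA : A ∈ G.completion.coords) : ∃ e ∈ G.edgeSet, (A : Set α) ⊆ e := by
  rcases hA with ⟨v, hv, rfl⟩ | ⟨_, h⟩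
  · simpa using hcov v hv
  · exact h

theorem finite_edges (hV : G.vertexSet.Finite) :
    {e : Finset α | (e : Set α) ∈ G.edgeSet}.Finite := by
  refine (hV.toFinset.powerset.finite_toSet).subset fun e he => ?_
  rw [mem_coe, mem_powerset]
  exact fun x hx => hV.mem_toFinset.mpr (G.subset_vertexSet_of_mem_edgeSet' he hx)

theorem exists_isMaximalEdge (hV : G.vertexSet.Finite) {e : Finset α}
    (he : (e : Set α) ∈ G.edgeSet) : ∃ f, e ⊆ f ∧ G.IsMaximalEdge f :=
  (G.finite_edges hV).exists_le_maximal he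

theorem adj_iff_exists_finset (hV : G.vertexSet.Finite) {u v : α} :
    G.Adj u v ↔ ∃ e : Finset α, (e : Set α) ∈ G.edgeSet ∧ u ∈ e ∧ v ∈ e := by
  constructor
  · rintro ⟨e, he, hu, hv⟩
    have hfin : e.Finite := hV.subset (G.subset_vertexSet_of_mem_edgeSet' he)
    exact ⟨hfin.toFinset, by simpa using he, by simpa using hu, by simpa using hv⟩
  · rintro ⟨e, he, hu, hv⟩
    exact ⟨e, he, hu, hv⟩

variable [DecidableEq α]

theorem rlt_eq_sum (z : G.coords → ℝ) (U e : Finset α) :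
    G.rlt z U e = ∑ W ∈ U.powerset, (-1 : ℝ) ^ W.card * G.value z ((e \ U) ∪ W) := by
  rw [rlt, sum_filter, sum_filter, ← sum_sub_distrib]
  refine sum_congr rfl fun W _ => ?_
  rcases Nat.even_or_odd W.card with h | h
  · simp [h, h.neg_one_pow]
  · simp [h, h.neg_one_pow]

theorem rlt_nonneg_of_moment {ι : Type*} [Fintype ι] {w : ι → ℝ} (hw : ∀ i, 0 ≤ w i)
    (T : ι → Finset α) {z : G.coords → ℝ} {e U : Finset α} (hU : U ⊆ e)
    (h : ∀ A ⊆ e, moment w T A = G.value z A) : 0 ≤ G.rlt z U e := by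
  rw [rlt_eq_sum]
  exact alternating_sum_nonneg hw T hU h

theorem exists_moment_of_rlt_nonneg {z : G.coords → ℝ} {e : Finset α}
    (h : ∀ U ⊆ e, 0 ≤ G.rlt z U e) :
    ∃ w : e.powerset → ℝ, (∀ i, 0 ≤ w i) ∧
      ∀ A ⊆ e, moment w (fun i => (i : Finset α)) A = G.value z A := by
  refine ⟨fun i => G.rlt z (e \ i) e, fun i => h _ sdiff_subset, fun A hA => ?_⟩
  rw [← sum_superset_alternating (G.value z) hA, moment, sum_filter]
  rw [Finset.sum_coe_sort e.powerset fun i => if A ⊆ i then G.rlt z (e \ i) e else 0]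
  refine sum_congr rfl fun T hT => ?_
  rw [rlt_eq_sum, Finset.sdiff_sdiff_eq_self (mem_powerset.mp hT)]

/-- A point of the complete edge relaxation restricts on every edge to the moments of a distribution
on the subsets of that edge. -/
theorem exists_moment_of_mem_completeEdgeRelaxation (hV : G.vertexSet.Finite)
    {z : G.completion.coords → ℝ} (hz : z ∈ G.completeEdgeRelaxation) {e : Finset α}
    (he : (e : Set α) ∈ G.edgeSet) :
    ∃ (f : Finset α) (w : f.powerset → ℝ), (∀ i, 0 ≤ w i) ∧
      ∀ A ⊆ e, moment w (fun i => (i : Finset α) ∩ e) A = G.completion.value z A := by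
  obtain ⟨f, hef, hf⟩ := G.exists_isMaximalEdge hV he
  obtain ⟨w, hw, h⟩ := G.completion.exists_moment_of_rlt_nonneg fun U hU => hz f hf U hU
  refine ⟨f, w, hw, fun A hA => ?_⟩
  rw [← h A (hA.trans hef)]
  refine sum_congr rfl fun i _ => if_congr ?_ rfl rfl
  simp [subset_inter_iff, hA]

theorem isPolyhedron_completeEdgeRelaxation (hV : G.vertexSet.Finite) :
    IsPolyhedron G.completeEdgeRelaxation := by
  classical
  -- `ev p` is the linear part of `z ↦ z_p`, whose constant part is `1` for `p = ∅` and `0` otherwise.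
  let ev : Finset α → Module.Dual ℝ (G.completion.coords → ℝ) := fun p =>
    if p = ∅ then 0 else if h : p ∈ G.completion.coords then LinearMap.proj ⟨p, h⟩ else 0
  have hev : ∀ z p, G.completion.value z p = ev p z + if p = ∅ then 1 else 0 := by
    intro z p
    simp only [value, ev]
    split_ifs <;> simp
  -- The inequality `0 ≤ ψ(U, e)` for `(e, U) = q`, with its linear part moved to the left.
  let c : Finset α × Finset α → Module.Dual ℝ (G.completion.coords → ℝ) × ℝ := fun q =>
    (-∑ W ∈ q.2.powerset, (-1 : ℝ) ^ W.card • ev ((q.1 \ q.2) ∪ W),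
      ∑ W ∈ q.2.powerset, (-1 : ℝ) ^ W.card * if (q.1 \ q.2) ∪ W = ∅ then 1 else 0)
  have hc : ∀ z q, (c q).1 z ≤ (c q).2 ↔ 0 ≤ G.completion.rlt z q.2 q.1 := by
    intro z q
    rw [rlt_eq_sum]
    simp only [c, hev, mul_add, sum_add_distrib, LinearMap.neg_apply, LinearMap.sum_apply,
      LinearMap.smul_apply, smul_eq_mul]
    rw [neg_le_iff_add_nonneg, add_comm]
  refine ⟨((hV.toFinset.powerset ×ˢ hV.toFinset.powerset).filter
    fun q => G.IsMaximalEdge q.1 ∧ q.2 ⊆ q.1).image c, ?_⟩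
  ext z
  simp only [completeEdgeRelaxation, Set.mem_ofPred_eq, forall_mem_image, mem_filter, hc]
  constructor
  · rintro h q ⟨_, h1, h2⟩
    exact h q.1 h1 q.2 h2
  · intro h e he U hU
    have heV : e ⊆ hV.toFinset := fun x hx =>
      hV.mem_toFinset.mpr (G.subset_vertexSet_of_mem_edgeSet' he.prop hx)
    exact @h (e, U) ⟨mem_product.mpr ⟨mem_powerset.mpr heV, mem_powerset.mpr (hU.trans heV)⟩,
      he, hU⟩

open Classical in
theorem exists_moment_of_mem_multilinearPolytope (hV : G.vertexSet.Finite)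
    {x : G.coords → ℝ} (hx : x ∈ G.multilinearPolytope) :
    ∃ (ι : Type) (_ : Fintype ι) (w : ι → ℝ) (T : ι → Finset α), (∀ i, 0 ≤ w i) ∧
      moment w T ∅ = 1 ∧ ∀ p : G.coords, moment w T p = x p := by
  obtain ⟨ι, _, w, s, hw, hw1, hs, rfl⟩ := mem_convexHull_iff_exists_fintype.mp hx
  refine ⟨ι, inferInstance, w,
    fun i => hV.toFinset.filter fun v => ∃ h : v ∈ G.vertexSet, s i (G.node h) = 1, hw, ?_, ?_⟩
  · simpa [moment] using hw1
  rintro ⟨p, hp⟩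
  rw [Finset.sum_apply]
  refine sum_congr rfl fun i _ => ?_
  have hmem : ∀ v (hv : v ∈ G.vertexSet), (v ∈ hV.toFinset.filter
      fun v => ∃ h : v ∈ G.vertexSet, s i (G.node h) = 1) ↔ s i (G.node hv) = 1 := by
    intro v hv
    simp [hv]
  have hval : s i ⟨p, hp⟩ = if p ⊆ hV.toFinset.filter
      (fun v => ∃ h : v ∈ G.vertexSet, s i (G.node h) = 1) then 1 else 0 := by
    rcases hp with ⟨v, hv, rfl⟩ | hp
    · split_ifs with hsub
      · exact (hmem v hv).mp (singleton_subset_iff.mp hsub)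
      · exact ((hs i).1 (G.node hv)).resolve_right fun h =>
          hsub (singleton_subset_iff.mpr ((hmem v hv).mpr h))
    · refine ((hs i).2 p hp).trans ?_
      split_ifs with hsub
      · exact prod_eq_one fun v _ => (hmem v (G.mem_vertexSet_of_mem hp v)).mp (hsub v.2)
      · obtain ⟨v, hvp, hv⟩ := not_subset.mp hsub
        refine prod_eq_zero (mem_univ ⟨v, hvp⟩) ?_
        exact ((hs i).1 _).resolve_right fun h =>
          hv ((hmem v (G.mem_vertexSet_of_mem hp ⟨v, hvp⟩)).mpr h)
  simp only [Pi.smul_apply, smul_eq_mul]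
  rw [hval]
  split_ifs <;> simp

theorem mem_multilinearPolytope_of_moment {ι : Type*} [Fintype ι] {w : ι → ℝ}
    (hw : ∀ i, 0 ≤ w i) (T : ι → Finset α) (h1 : moment w T ∅ = 1) {x : G.coords → ℝ}
    (hx : ∀ p : G.coords, moment w T p = x p) : x ∈ G.multilinearPolytope := by
  refine mem_convexHull_of_exists_fintype w
    (fun i p => if (p : Finset α) ⊆ T i then 1 else 0) hw (by simpa [moment] using h1) ?_ ?_
  · intro i
    refine ⟨fun p => by dsimp only; split_ifs <;> simp, fun e he => ?_⟩
    dsimp only [edge, node]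
    simp only [singleton_subset_iff]
    split_ifs with h
    · exact (prod_eq_one fun v _ => if_pos (h v.2)).symm
    · obtain ⟨v, hve, hv⟩ := not_subset.mp h
      exact (prod_eq_zero (mem_univ ⟨v, hve⟩) (if_neg hv)).symm
  · ext p
    rw [Finset.sum_apply, ← hx p, moment]
    refine sum_congr rfl fun i _ => ?_
    simp

theorem exists_mem_completeEdgeRelaxation_of_mem (hV : G.vertexSet.Finite)
    (hE : ∀ e ∈ G.edgeSet, 2 ≤ e.ncard) {x : G.coords → ℝ} (hx : x ∈ G.multilinearPolytope) :
    ∃ z ∈ G.completeEdgeRelaxation,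
      ∀ i, z (Set.embeddingOfSubset _ _ (G.coords_subset_completion hE) i) = x i := by
  obtain ⟨ι, _, w, T, hw, h1, hm⟩ := G.exists_moment_of_mem_multilinearPolytope hV hx
  refine ⟨fun p => moment w T p, fun e he U hU => ?_, fun i => hm i⟩
  refine G.completion.rlt_nonneg_of_moment hw T hU fun A hA => ?_
  by_cases hne : A = ∅
  · rw [hne, h1, value_empty]
  · rw [G.completion.value_of_mem (G.coords_completion_of_subset he.prop hA hne) hne]

end Relaxation

/-! ### Gluing along a running intersection order -/

section Sufficiency

universe u

variable {α : Type u} [DecidableEq α] (G : Hypergraph α)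

/-- Local distributions with moments `z` on the sets `F k` of a running intersection order glue to a
distribution with moments `z` on all of them: the next set meets the union of the preceding ones
inside one of them, where both distributions have moments `z`. -/
theorem exists_moment_of_runningIntersection {z : Finset α → ℝ} (hz : z ∅ = 1) {m : ℕ}
    (F : Fin m → Finset α)
    (hloc : ∀ k, ∃ (κ : Type u) (_ : Fintype κ) (w : κ → ℝ) (R : κ → Finset α),
      (∀ j, 0 ≤ w j) ∧ (∀ j, R j ⊆ F k) ∧ ∀ A ⊆ F k, moment w R A = z A)
    (hrip : ∀ k : Fin m, 0 < (k : ℕ) →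
      ∃ j < k, ∀ x ∈ F k, (∃ i < k, x ∈ F i) → x ∈ F j)
    (k : ℕ) (hk : k ≤ m) :
    ∃ (ι : Type u) (_ : Fintype ι) (w : ι → ℝ) (T : ι → Finset α), (∀ i, 0 ≤ w i) ∧
      (∀ i, T i ⊆ univ.biUnion fun j : Fin m => if (j : ℕ) < k then F j else ∅) ∧
      moment w T ∅ = 1 ∧ ∀ j : Fin m, (j : ℕ) < k → ∀ A ⊆ F j, moment w T A = z A := by
  induction k with
  | zero =>
    refine ⟨PUnit, inferInstance, fun _ => 1, fun _ => ∅, fun _ => zero_le_one, fun _ => by simp,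
      by simp [moment], fun j hj => absurd hj (Nat.not_lt_zero _)⟩
  | succ k ih =>
    obtain ⟨ι, _, w, T, hw, hT, h1, hm⟩ := ih (by omega)
    obtain ⟨κ, _, u, R, hu, hR, hmu⟩ := hloc ⟨k, hk⟩
    set X := univ.biUnion fun j : Fin m => if (j : ℕ) < k then F j else ∅ with hX
    have hmemX : ∀ x, x ∈ X ↔ ∃ j : Fin m, (j : ℕ) < k ∧ x ∈ F j := by
      intro x
      simp only [hX, mem_biUnion, mem_univ, true_and]
      refine exists_congr fun j => ?_
      split_ifs with hj <;> simp [hj]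
    obtain ⟨p, hp, hpX, hpY⟩ := exists_glued_moments hw hu hT hR fun A hA => by
      have hAY : A ⊆ F ⟨k, hk⟩ := hA.trans inter_subset_right
      rw [hmu A hAY]
      rcases Nat.eq_zero_or_pos k with rfl | hk0
      · have : A = ∅ := by
          refine eq_empty_of_forall_notMem fun x hx => ?_
          obtain ⟨j, hj, _⟩ := (hmemX x).mp (mem_inter.mp (hA hx)).1
          exact Nat.not_lt_zero _ hj
        rw [this, h1, hz]
      · obtain ⟨j, hj, hsub⟩ := hrip ⟨k, hk⟩ hk0
        refine hm j hj A fun x hx => hsub x (hAY hx) ?_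
        obtain ⟨i, hi, hxi⟩ := (hmemX x).mp (mem_inter.mp (hA hx)).1
        exact ⟨i, hi, hxi⟩
    refine ⟨ι × κ, inferInstance, p, _, hp, ?_, (hpX ∅ (empty_subset _)).trans h1, ?_⟩
    · rintro ⟨i, j⟩ x hx
      simp only [mem_biUnion, mem_univ, true_and]
      rcases mem_union.mp hx with hx | hx
      · obtain ⟨l, hl, hxl⟩ := (hmemX x).mp (hT i hx)
        exact ⟨l, by rwa [if_pos (by omega)]⟩
      · exact ⟨⟨k, hk⟩, by rw [if_pos (Nat.lt_succ_self k)]; exact hR j hx⟩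
    · intro j hj A hA
      rcases Nat.lt_succ_iff_lt_or_eq.mp hj with hj | hj
      · rw [hpX A fun x hx => (hmemX x).mpr ⟨j, hj, hA hx⟩, hm j hj A hA]
      · have hjk : j = ⟨k, hk⟩ := Fin.ext hj
        subst hjk
        rw [hpY A hA, hmu A hA]

theorem mem_multilinearPolytope_of_isAlphaAcyclic (hV : G.vertexSet.Finite)
    (hE : ∀ e ∈ G.edgeSet, 2 ≤ e.ncard)
    (hcov : ∀ v ∈ G.vertexSet, ∃ e ∈ G.edgeSet, v ∈ e) (hG : G.IsAlphaAcyclic)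
    {z : G.completion.coords → ℝ} (hz : z ∈ G.completeEdgeRelaxation) :
    (fun p => z (Set.embeddingOfSubset _ _ (G.coords_subset_completion hE) p)) ∈
      G.multilinearPolytope := by
  obtain ⟨m, f, _, hrange, hrip⟩ := hG
  have hf : ∀ k, f k ∈ G.edgeSet := fun k => hrange ▸ Set.mem_range_self k
  have hfin : ∀ k, (f k).Finite := fun k =>
    hV.subset (G.subset_vertexSet_of_mem_edgeSet' (hf k))
  obtain ⟨ι, _, w, T, hw, _, h1, hm⟩ := exists_moment_of_runningIntersection
    (G.completion.value_empty z) (fun k => (hfin k).toFinset)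
    (fun k => by
      obtain ⟨e, u, hu, hmu⟩ := G.exists_moment_of_mem_completeEdgeRelaxation hV hz
        (e := (hfin k).toFinset) (by simpa using hf k)
      exact ⟨_, _, u, _, hu, fun _ => inter_subset_right, hmu⟩)
    (fun k hk => by
      obtain ⟨j, hj, hsub⟩ := hrip k hk
      refine ⟨j, hj, fun x hx ⟨i, hi, hxi⟩ => (hfin j).mem_toFinset.mpr (hsub ⟨?_, ?_⟩)⟩
      · exact (hfin k).mem_toFinset.mp hx
      · exact Set.mem_iUnion₂.mpr ⟨i, hi, (hfin i).mem_toFinset.mp hxi⟩) m le_rfl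
  refine G.mem_multilinearPolytope_of_moment hw T h1 fun p => ?_
  have hp := G.coords_subset_completion hE p.2
  obtain ⟨e, he, hpe⟩ := G.exists_subset_of_mem_coords_completion hcov hp
  obtain ⟨j, rfl⟩ := hrange.symm ▸ he
  rw [hm j j.2 p fun x hx => (hfin j).mem_toFinset.mpr (hpe hx),
    G.completion.value_of_mem hp (G.ne_empty_of_mem_coords hE p.2)]
  rfl

end Sufficiency

/-! ### Obstructions to acyclicity -/

section Necessity

variable {α : Type*} [DecidableEq α] (G : Hypergraph α)

/-- The projection of the complete edge relaxation to the coordinates `V ∪ E` is contained in the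
multilinear polytope. This is the part of being an extension that can fail. -/
def RelaxationProjectsInto (hE : ∀ e ∈ G.edgeSet, 2 ≤ e.ncard) : Prop :=
  ∀ z ∈ G.completeEdgeRelaxation,
    (fun p => z (Set.embeddingOfSubset _ _ (G.coords_subset_completion hE) p)) ∈
      G.multilinearPolytope

variable {G}

/-- Moments `ζ` that are realizable on every edge are, at the nodes and edges, the moments of a
global distribution. Nothing is claimed about the other subsets of edges. -/
theorem RelaxationProjectsInto.exists_moment {hE : ∀ e ∈ G.edgeSet, 2 ≤ e.ncard}
    (hG : G.RelaxationProjectsInto hE) (hV : G.vertexSet.Finite) {ζ : Finset α → ℝ}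
    (h1 : ζ ∅ = 1)
    (hloc : ∀ e : Finset α, (e : Set α) ∈ G.edgeSet → ∀ U ⊆ e,
      0 ≤ ∑ W ∈ U.powerset, (-1 : ℝ) ^ W.card * ζ ((e \ U) ∪ W)) :
    ∃ (ι : Type) (_ : Fintype ι) (w : ι → ℝ) (T : ι → Finset α), (∀ i, 0 ≤ w i) ∧
      moment w T ∅ = 1 ∧ (∀ v ∈ G.vertexSet, moment w T {v} = ζ {v}) ∧
      ∀ e : Finset α, (e : Set α) ∈ G.edgeSet → moment w T e = ζ e := by
  have hz : (fun p : G.completion.coords => ζ p) ∈ G.completeEdgeRelaxation := by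
    intro e he U hU
    rw [rlt_eq_sum]
    have h2 : ∀ W ∈ U.powerset, (-1 : ℝ) ^ W.card *
        G.completion.value (fun p : G.completion.coords => ζ p) ((e \ U) ∪ W) =
        (-1 : ℝ) ^ W.card * ζ ((e \ U) ∪ W) := by
      intro W hW
      have hsub := union_subset (sdiff_subset (s := e) (t := U)) ((mem_powerset.mp hW).trans hU)
      by_cases hne : (e \ U) ∪ W = ∅
      · rw [hne, value_empty, h1]
      · rw [G.completion.value_of_mem (G.coords_completion_of_subset he.prop hsub hne) hne]
    rw [sum_congr rfl h2]
    exact hloc e he.prop U hU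
  obtain ⟨ι, hι, w, T, hw, hw1, hm⟩ := G.exists_moment_of_mem_multilinearPolytope hV (hG _ hz)
  exact ⟨ι, hι, w, T, hw, hw1, fun v hv => hm (G.node hv), fun e he => hm (G.edge he)⟩

/-- If all facets `S \ {s}` of a set `S` of at least three nodes lie in edges, then so does `S`.
Otherwise, with `n = |S|`, consider the moments `1 - |S ∩ A| / (n - 1)`. An edge misses some `s ∈ S`,
and these are the moments of removing from it a uniformly random element of `S \ {s}`. A global
distribution would almost surely contain no facet, thus miss at least two elements of `S`, while
the moments of the nodes prescribe the mean size `n (n - 2) / (n - 1) > n - 2` of its trace. -/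
theorem RelaxationProjectsInto.exists_edge_superset {hE : ∀ e ∈ G.edgeSet, 2 ≤ e.ncard}
    (hG : G.RelaxationProjectsInto hE) (hV : G.vertexSet.Finite) {S : Finset α}
    (hS : 3 ≤ S.card) (hSV : ∀ v ∈ S, v ∈ G.vertexSet)
    (hfacet : ∀ s ∈ S, ∃ e : Finset α, (e : Set α) ∈ G.edgeSet ∧ S.erase s ⊆ e) :
    ∃ e : Finset α, (e : Set α) ∈ G.edgeSet ∧ S ⊆ e := by
  by_contra! hcon
  have hn : (3 : ℝ) ≤ S.card := by exact_mod_cast hS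
  have hn1 : (S.card : ℝ) - 1 ≠ 0 := by linarith
  obtain ⟨ι, _, w, T, hw, hw1, hnode, hedge⟩ := hG.exists_moment hV
    (ζ := fun A => 1 - ((S ∩ A).card : ℝ) / (S.card - 1)) (by simp) (by
      intro e he U hU
      obtain ⟨s, hs, hse⟩ := not_subset.mp (hcon e he)
      refine alternating_sum_nonneg (ι := S.erase s) (w := fun _ => 1 / ((S.card : ℝ) - 1))
        (z := fun A => 1 - ((S ∩ A).card : ℝ) / (S.card - 1))
        (fun _ => div_nonneg zero_le_one (by linarith)) (fun i => e.erase i) hU fun A hA => ?_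
      have hsA : s ∉ A := fun h => hse (hA h)
      have h1 : ∀ i : α, A ⊆ e.erase i ↔ i ∉ A := fun i =>
        ⟨fun h hi => notMem_erase i e (h hi),
          fun h x hx => mem_erase.mpr ⟨fun hxi => h (hxi ▸ hx), hA hx⟩⟩
      have h2 : (S.erase s).filter (· ∉ A) = S.erase s \ A := by
        ext x
        simp
      have h3 : S.erase s ∩ A = S ∩ A := by
        rw [erase_inter, erase_eq_of_notMem fun h => hsA (mem_inter.mp h).2]
      have h4 := card_sdiff_add_card_inter (S.erase s) A
      rw [h3, card_erase_of_mem hs] at h4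
      have h5 : ((S.erase s \ A).card : ℝ) = S.card - 1 - (S ∩ A).card := by
        have h6 : (S.erase s \ A).card + (S ∩ A).card + 1 = S.card := by omega
        rw [← h6]
        push_cast
        ring
      simp only [moment, h1]
      rw [Finset.sum_coe_sort (S.erase s) fun i => if i ∉ A then 1 / ((S.card : ℝ) - 1) else 0,
        ← sum_filter, h2, sum_const, nsmul_eq_mul, h5]
      field_simp)
  -- Nodes outside `S` have moment `1`, so they belong to every set of positive weight.
  have hout : ∀ i, w i ≠ 0 → ∀ v ∈ G.vertexSet, v ∉ S → v ∈ T i := by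
    intro i hi v hv hvS
    refine singleton_subset_iff.mp
      (subset_of_moment_eq hw (empty_subset {v}) ?_ hi (empty_subset _))
    rw [hw1, hnode v hv, inter_singleton_of_notMem hvS]
    simp
  have hmiss : ∀ i, w i ≠ 0 → ∀ s ∈ S, ¬ S.erase s ⊆ T i := by
    intro i hi s hs hsub
    obtain ⟨e, he, hse⟩ := hfacet s hs
    have hseS : S ∩ e = S.erase s := by
      refine Subset.antisymm (fun x hx => ?_)
        fun x hx => mem_inter.mpr ⟨mem_of_mem_erase hx, hse hx⟩
      obtain ⟨hxS, hxe⟩ := mem_inter.mp hx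
      refine mem_erase.mpr ⟨?_, hxS⟩
      rintro rfl
      refine hcon e he fun y hy => ?_
      by_cases hyx : y = x
      · exact hyx ▸ hxe
      · exact hse (mem_erase.mpr ⟨hyx, hy⟩)
    refine not_subset_of_moment_eq_zero hw (T := T) (A := e) ?_ hi fun x hx => ?_
    · rw [hedge e he, hseS, card_erase_of_mem hs, Nat.cast_sub (by omega)]
      simp [div_self hn1]
    · by_cases hxS : x ∈ S
      · exact hsub (hseS ▸ mem_inter.mpr ⟨hxS, hx⟩)
      · exact hout i hi x (G.mem_vertexSet_of_mem he ⟨x, hx⟩) hxS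
  have hcard : ∀ i, w i ≠ 0 → ((S.filter (· ∈ T i)).card : ℝ) ≤ S.card - 2 := by
    intro i hi
    have h1 : 1 < (S.filter (· ∉ T i)).card := by
      rw [one_lt_card]
      obtain ⟨s, hs⟩ : S.Nonempty := card_pos.mp (by omega)
      obtain ⟨x, hx, hxT⟩ := not_subset.mp (hmiss i hi s hs)
      obtain ⟨y, hy, hyT⟩ := not_subset.mp (hmiss i hi x (mem_of_mem_erase hx))
      exact ⟨x, mem_filter.mpr ⟨mem_of_mem_erase hx, hxT⟩, y,
        mem_filter.mpr ⟨mem_of_mem_erase hy, hyT⟩, (ne_of_mem_erase hy).symm⟩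
    have h2 := card_filter_add_card_filter_not (s := S) (· ∈ T i)
    have h3 : (S.filter (· ∈ T i)).card + 2 ≤ S.card := by omega
    have h4 : ((S.filter (· ∈ T i)).card : ℝ) + 2 ≤ S.card := by exact_mod_cast h3
    linarith
  have hsum1 : ∑ v ∈ S, moment w T {v} = S.card * (1 - 1 / (S.card - 1)) := by
    rw [sum_congr rfl fun v hv => by
      rw [hnode v (hSV v hv), inter_singleton_of_mem hv, card_singleton], sum_const, nsmul_eq_mul]
    simp
  have hsum2 : ∑ v ∈ S, moment w T {v} ≤ S.card - 2 := by
    have h1 : ∑ v ∈ S, moment w T {v} = ∑ i, (S.filter (· ∈ T i)).card * w i := by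
      simp only [moment, singleton_subset_iff]
      rw [sum_comm]
      refine sum_congr rfl fun i _ => ?_
      rw [← sum_filter, sum_const, nsmul_eq_mul]
    have h2 : ∑ i, w i = 1 := by simpa [moment] using hw1
    rw [h1]
    calc ∑ i, ((S.filter (· ∈ T i)).card : ℝ) * w i ≤ ∑ i, ((S.card : ℝ) - 2) * w i := by
          refine sum_le_sum fun i _ => ?_
          by_cases hi : w i = 0
          · simp [hi]
          · exact mul_le_mul_of_nonneg_right (hcard i hi) (hw i)
      _ = S.card - 2 := by rw [← mul_sum, h2, mul_one]
  have h3 : (S.card : ℝ) * (1 - 1 / (S.card - 1)) = S.card - 2 + (S.card - 2) / (S.card - 1) := by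
    field_simp
    ring
  have h4 : 0 < ((S.card : ℝ) - 2) / (S.card - 1) := div_pos (by linarith) (by linarith)
  linarith

theorem RelaxationProjectsInto.exists_edge_of_clique {hE : ∀ e ∈ G.edgeSet, 2 ≤ e.ncard}
    (hG : G.RelaxationProjectsInto hE) (hV : G.vertexSet.Finite) (K : Finset α)
    (hne : K.Nonempty) (hKV : ∀ v ∈ K, v ∈ G.vertexSet) (hK : ∀ x ∈ K, ∀ y ∈ K, G.Adj x y) :
    ∃ e : Finset α, (e : Set α) ∈ G.edgeSet ∧ K ⊆ e := by
  induction K using Finset.strongInduction with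
  | H K ih =>
    rcases Nat.lt_or_ge K.card 3 with h | h
    · obtain ⟨x, hx⟩ := hne
      obtain ⟨y, hy, hxy⟩ : ∃ y ∈ K, K ⊆ {x, y} := by
        rcases (K.erase x).eq_empty_or_nonempty with h0 | ⟨y, hy⟩
        · refine ⟨x, hx, fun z hz => ?_⟩
          by_contra hzx
          have : z ∈ K.erase x := mem_erase.mpr ⟨by simpa using hzx, hz⟩
          simp [h0] at this
        · refine ⟨y, mem_of_mem_erase hy, (eq_of_subset_of_card_le ?_ ?_).symm.subset⟩
          · exact insert_subset hx (singleton_subset_iff.mpr (mem_of_mem_erase hy))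
          · rw [card_pair (ne_of_mem_erase hy).symm]
            omega
      obtain ⟨e, he, hxe, hye⟩ := (G.adj_iff_exists_finset hV).mp (hK x hx y hy)
      exact ⟨e, he, hxy.trans (insert_subset hxe (singleton_subset_iff.mpr hye))⟩
    · refine hG.exists_edge_superset hV h hKV fun s hs => ?_
      exact ih (K.erase s) (erase_ssubset hs) (card_pos.mp (by rw [card_erase_of_mem hs]; omega))
        (fun v hv => hKV v (mem_of_mem_erase hv))
        fun x hx y hy => hK x (mem_of_mem_erase hx) y (mem_of_mem_erase hy)

/-- The 2-section satisfies the chordality condition of `exists_simplicial`. If `b` and `b'` were not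
adjacent, let `S` consist of `C`, `a`, `b`, `b'`. On each edge, let the nodes outside `S` be
present and those in `S` be all present or all absent with probability `1 / 2`, except that on an
edge containing `a` and `b'` exactly one of these two is present; such an edge contains no other
node of `S`, so the local distributions are consistent. A global distribution would almost surely
make `a`, `b`, the nodes of `C`, and `b'` equal in turn, but `a` and `b'` opposite. -/
theorem RelaxationProjectsInto.adj_of_common_component {hE : ∀ e ∈ G.edgeSet, 2 ≤ e.ncard}
    (hG : G.RelaxationProjectsInto hE) (hV : G.vertexSet.Finite) {C : Finset α}
    (hC : IsConnectedIn G.Adj C) (hCV : ∀ c ∈ C, c ∈ G.vertexSet) {a b b' : α}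
    (haC : ∀ c ∈ C, ¬ G.Adj a c) (hb : ∃ c ∈ C, G.Adj b c) (hb' : ∃ c ∈ C, G.Adj b' c)
    (hab : G.Adj a b) (hab' : G.Adj a b') : G.Adj b b' := by
  simp only [G.adj_iff_exists_finset hV] at haC hb hb' hab hab' ⊢
  by_contra hbb'
  obtain ⟨c, hc, e₁, he₁, hbe₁, hce₁⟩ := hb
  obtain ⟨c', hc', e₂, he₂, hbe₂, hce₂⟩ := hb'
  obtain ⟨e₃, he₃, hae₃, hbe₃⟩ := hab
  obtain ⟨e₄, he₄, hae₄, hbe₄⟩ := hab'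
  have hne : a ≠ b' := by
    rintro rfl
    exact haC c' hc' ⟨e₂, he₂, hbe₂, hce₂⟩
  set S := insert a (insert b (insert b' C)) with hS
  have haS : a ∈ S := by simp [hS]
  have hbS : b ∈ S := by simp [hS]
  have hbS' : b' ∈ S := by simp [hS]
  have hCS : C ⊆ S := fun x hx => by simp [hS, hx]
  have hSV : ∀ x ∈ S, x ∈ G.vertexSet := by
    intro x hx
    simp only [hS, mem_insert] at hx
    rcases hx with hx | hx | hx | hx
    · exact G.mem_vertexSet_of_mem he₃ ⟨x, hx ▸ hae₃⟩
    · exact G.mem_vertexSet_of_mem he₃ ⟨x, hx ▸ hbe₃⟩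
    · exact G.mem_vertexSet_of_mem he₄ ⟨x, hx ▸ hbe₄⟩
    · exact hCV x hx
  have hkey : ∀ e : Finset α, (e : Set α) ∈ G.edgeSet → a ∈ e → b' ∈ e →
      ∀ x ∈ e, x ∈ S → x = a ∨ x = b' := by
    intro e he hae hbe x hxe hxS
    simp only [hS, mem_insert] at hxS
    rcases hxS with rfl | rfl | rfl | hx
    · exact Or.inl rfl
    · exact absurd ⟨e, he, hxe, hbe⟩ hbb'
    · exact Or.inr rfl
    · exact absurd ⟨e, he, hae, hxe⟩ (haC x hx)
  let ζ : Finset α → ℝ :=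
    fun A => if a ∈ A ∧ b' ∈ A then 0 else if Disjoint A S then 1 else 1 / 2
  obtain ⟨ι, _, w, T, hw, hw1, hnode, hedge⟩ := hG.exists_moment hV
    (ζ := ζ) (by simp [ζ]) (by
      intro e he U hU
      by_cases hab : a ∈ e ∧ b' ∈ e
      · refine alternating_sum_nonneg (ι := Bool) (w := fun _ => 1 / 2) (z := ζ)
          (fun _ => by norm_num) (fun i => if i then e.erase b' else e.erase a) hU fun A hA => ?_
        have h1 : ∀ x, A ⊆ e.erase x ↔ x ∉ A := fun x =>
          ⟨fun h hx => notMem_erase x e (h hx),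
            fun h y hy => mem_erase.mpr ⟨fun hyx => h (hyx ▸ hy), hA hy⟩⟩
        have h2 : Disjoint A S ↔ a ∉ A ∧ b' ∉ A := by
          rw [disjoint_left]
          refine ⟨fun h => ⟨fun ha => h ha haS, fun hb => h hb hbS'⟩, fun h x hx hxS => ?_⟩
          rcases hkey e he hab.1 hab.2 x (hA hx) hxS with rfl | rfl
          · exact h.1 hx
          · exact h.2 hx
        simp only [ζ, moment, Fintype.sum_bool, if_true, Bool.false_eq_true, if_false, h1, h2]
        by_cases h3 : a ∈ A <;> by_cases h4 : b' ∈ A <;> (simp [h3, h4]; try norm_num)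
      · refine alternating_sum_nonneg (ι := Bool) (w := fun _ => 1 / 2) (z := ζ)
          (fun _ => by norm_num) (fun i => if i then e else e \ S) hU fun A hA => ?_
        have h1 : ¬ (a ∈ A ∧ b' ∈ A) := fun h => hab ⟨hA h.1, hA h.2⟩
        have h2 : A ⊆ e \ S ↔ Disjoint A S := by
          rw [subset_sdiff]
          exact ⟨fun h => h.2, fun h => ⟨hA, h⟩⟩
        simp only [ζ, moment, Fintype.sum_bool, if_true, Bool.false_eq_true, if_false, h1, h2, hA]
        split_ifs <;> norm_num)
  simp only [ζ] at hnode hedge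
  have hout : ∀ i, w i ≠ 0 → ∀ v ∈ G.vertexSet, v ∉ S → v ∈ T i := by
    intro i hi v hv hvS
    refine singleton_subset_iff.mp
      (subset_of_moment_eq hw (empty_subset {v}) ?_ hi (empty_subset _))
    rw [hw1, hnode v hv, if_neg, if_pos (disjoint_singleton_left.mpr hvS)]
    simp only [mem_singleton]
    exact fun h => hne (h.1.trans h.2.symm)
  have hhalf : ∀ v ∈ S, moment w T {v} = 1 / 2 := by
    intro v hv
    rw [hnode v (hSV v hv), if_neg, if_neg (by simpa using hv)]
    simp only [mem_singleton]
    exact fun h => hne (h.1.trans h.2.symm)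
  have hstep : ∀ i, w i ≠ 0 → ∀ e : Finset α, (e : Set α) ∈ G.edgeSet → ¬ (a ∈ e ∧ b' ∈ e) →
      ∀ u ∈ S, ∀ v ∈ S, u ∈ e → v ∈ e → u ∈ T i → v ∈ T i := by
    intro i hi e he hnab u hu v hv hue hve huT
    refine subset_of_moment_eq hw (singleton_subset_iff.mpr hue) ?_ hi
      (singleton_subset_iff.mpr huT) hve
    rw [hhalf u hu, hedge e he, if_neg hnab, if_neg]
    exact not_disjoint_iff.mpr ⟨u, hue, hu⟩
  have hiff : ∀ i, w i ≠ 0 → ∀ e : Finset α, (e : Set α) ∈ G.edgeSet → ¬ (a ∈ e ∧ b' ∈ e) →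
      ∀ u ∈ S, ∀ v ∈ S, u ∈ e → v ∈ e → (u ∈ T i ↔ v ∈ T i) :=
    fun i hi e he hnab u hu v hv hue hve => ⟨hstep i hi e he hnab u hu v hv hue hve,
      hstep i hi e he hnab v hv u hu hve hue⟩
  have hnotC : ∀ e : Finset α, (e : Set α) ∈ G.edgeSet → ∀ x ∈ C, x ∈ e → ¬ (a ∈ e ∧ b' ∈ e) :=
    fun e he x hx hxe h => haC x hx ⟨e, he, h.1, hxe⟩
  have hnota : ∀ i, w i ≠ 0 → a ∉ T i := by
    intro i hi haT
    have hbT : b' ∈ T i := by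
      rw [hiff i hi e₂ he₂ (hnotC e₂ he₂ c' hc' hce₂) b' hbS' c' (hCS hc') hbe₂ hce₂,
        ← hC (· ∈ T i) (fun u hu v hv huv => by
          obtain ⟨e, he, hue, hve⟩ := (G.adj_iff_exists_finset hV).mp huv
          exact hiff i hi e he (hnotC e he u hu hue) u (hCS hu) v (hCS hv) hue hve) c hc c' hc',
        ← hiff i hi e₁ he₁ (hnotC e₁ he₁ c hc hce₁) b hbS c (hCS hc) hbe₁ hce₁,
        ← hiff i hi e₃ he₃ (fun h => hbb' ⟨e₃, he₃, hbe₃, h.2⟩) a haS b hbS hae₃ hbe₃]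
      exact haT
    refine not_subset_of_moment_eq_zero hw (T := T) (A := e₄) ?_ hi fun x hx => ?_
    · rw [hedge e₄ he₄, if_pos ⟨hae₄, hbe₄⟩]
    · by_cases hxS : x ∈ S
      · rcases hkey e₄ he₄ hae₄ hbe₄ x hx hxS with rfl | rfl
        · exact haT
        · exact hbT
      · exact hout i hi x (G.mem_vertexSet_of_mem he₄ ⟨x, hx⟩) hxS
  have hzero : moment w T {a} = 0 := by
    refine sum_eq_zero fun i _ => ?_
    by_cases hi : w i = 0
    · simp [hi]
    · rw [if_neg]
      simpa using hnota i hi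
  rw [hhalf a haS] at hzero
  norm_num at hzero

theorem RelaxationProjectsInto.isAlphaAcyclic {hE : ∀ e ∈ G.edgeSet, 2 ≤ e.ncard}
    (hG : G.RelaxationProjectsInto hE) (hV : G.vertexSet.Finite)
    (hcov : ∀ v ∈ G.vertexSet, ∃ e ∈ G.edgeSet, v ∈ e) : G.IsAlphaAcyclic := by
  classical
  have hfin : ∀ e ∈ G.edgeSet, e.Finite := fun e he =>
    hV.subset (G.subset_vertexSet_of_mem_edgeSet' he)
  have hrefl : ∀ v ∈ G.vertexSet, G.Adj v v := by
    intro v hv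
    obtain ⟨e, he, hve⟩ := hcov v hv
    exact ⟨e, he, hve, hve⟩
  have hmemE : ∀ e, e ∈ (G.finite_edges hV).toFinset ↔ (e : Set α) ∈ G.edgeSet := by simp
  obtain ⟨L, hnd, hmem, hL⟩ := exists_runsOn (E := (G.finite_edges hV).toFinset) hV.toFinset (by
    intro X hX hne
    have hXV : ∀ x ∈ X, x ∈ G.vertexSet := fun x hx => hV.mem_toFinset.mp (hX hx)
    obtain ⟨v, hvX, hv⟩ := exists_simplicial (fun _ _ h => h.symm) X hne
      fun C hCX hC a _ b _ b' _ _ haC hb hb' hab hab' _ =>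
        hG.adj_of_common_component hV hC (fun c hc => hXV c (hCX hc)) haC hb hb' hab hab'
    have hvK : v ∈ X.filter (G.Adj v) := mem_filter.mpr ⟨hvX, hrefl v (hXV v hvX)⟩
    obtain ⟨e, he, hKe⟩ := hG.exists_edge_of_clique hV (X.filter (G.Adj v)) ⟨v, hvK⟩
      (fun x hx => hXV x (mem_filter.mp hx).1) (by
        intro x hx y hy
        obtain ⟨hx, hvx⟩ := mem_filter.mp hx
        obtain ⟨hy, hvy⟩ := mem_filter.mp hy
        by_cases hxy : x = y
        · exact hxy ▸ hrefl x (hXV x hx)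
        · exact hv x hx y hy hvx hvy hxy)
    refine ⟨v, hvX, e, (hmemE e).mpr he, hKe hvK, fun x hx ⟨g, hg, hvg, hxg⟩ => ?_⟩
    exact hKe (mem_filter.mpr ⟨hx, g, (hmemE g).mp hg, hvg, hxg⟩))
    hV.toFinset subset_rfl _ subset_rfl fun e he => ⟨e, he, fun x _ h => h⟩
  refine ⟨L.length, fun k => (L[(k.rev : ℕ)] : Finset α), ?_, ?_, ?_⟩
  · intro k l hkl
    have h1 := (hnd.getElem_inj_iff).mp (coe_injective hkl)
    exact Fin.rev_injective (Fin.ext h1)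
  · ext e
    constructor
    · rintro ⟨k, rfl⟩
      exact (hmemE _).mp ((hmem _).mp (List.getElem_mem _))
    · intro he
      have h1 : (hfin e he).toFinset ∈ L := (hmem _).mpr ((hmemE _).mpr (by simpa using he))
      obtain ⟨p, hp, hpe⟩ := List.mem_iff_getElem.mp h1
      refine ⟨Fin.rev ⟨p, hp⟩, ?_⟩
      simp [Fin.rev_rev, hpe]
  · intro k hk
    have hlt := k.2
    have hrev : (k.rev : ℕ) + 1 < L.length := by
      rw [Fin.val_rev]
      omega
    obtain ⟨q, hq, hpq, h⟩ := hL.exists_index k.rev hrev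
    refine ⟨Fin.rev ⟨q, hq⟩, ?_, ?_⟩
    · rw [Fin.lt_def, Fin.val_rev]
      rw [Fin.val_rev] at hpq
      dsimp only
      omega
    · rintro x ⟨hxk, hx⟩
      obtain ⟨i, hi, hxi⟩ := Set.mem_iUnion₂.mp hx
      have hxV : x ∈ hV.toFinset := hV.mem_toFinset.mpr (G.subset_vertexSet_of_mem_edgeSet'
        ((hmemE _).mp ((hmem _).mp (List.getElem_mem _))) hxk)
      have h1 := h x hxV k.rev.2 hxk ⟨i.rev, i.rev.2, Fin.rev_lt_rev.mpr hi, hxi⟩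
      simpa [Fin.rev_rev] using h1

end Necessity

end Hypergraph

theorem theorem1 {α : Type*} [DecidableEq α] (G : Hypergraph α)
    (hV : G.vertexSet.Finite)
    (hE : ∀ e ∈ G.edgeSet, 2 ≤ e.ncard)
    (hcov : ∀ v ∈ G.vertexSet, ∃ e ∈ G.edgeSet, v ∈ e) :
    IsExtension (Set.embeddingOfSubset _ _ (G.coords_subset_completion hE))
        G.multilinearPolytope G.completeEdgeRelaxation ↔
      G.IsAlphaAcyclic := by
  constructor
  · rintro ⟨-, hP⟩
    exact Hypergraph.RelaxationProjectsInto.isAlphaAcyclic (hE := hE)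
      (fun z hz => hP ▸ ⟨z, hz, fun _ => rfl⟩) hV hcov
  · intro hG
    refine ⟨G.isPolyhedron_completeEdgeRelaxation hV, Set.Subset.antisymm
      (fun x hx => G.exists_mem_completeEdgeRelaxation_of_mem hV hE hx) ?_⟩
    rintro x ⟨z, hz, hx⟩
    rw [← funext hx]
    exact G.mem_multilinearPolytope_of_isAlphaAcyclic hV hE hcov hG hz
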